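/- **Corollary 4.2.** Let $\mathcal H$ be a real Hilbert space. Let $S\colon\mathcal H\to\mathcal H$ be a bounded, self-adjoint linear operator that is strongly positive, i.e. $\langle Sx,x\rangle\ge m\|x\|^2$ for all $x$ and some $m>0$, and write $\|x\|_S=\sqrt{\langle Sx,x\rangle}$ and $\|x\|_{S^{-1}}=\sqrt{\langle S^{-1}x,x\rangle}$. Let $A\colon\mathcal H\to2^{\mathcal H}$ be maximally monotone and let $C\colon\mathcal H\to\mathcal H$ be such that either $C=0$ and $\ell=0$, or $C\neq0$, $\ell>0$ and $\langle Cx-Cy,x-y\rangle\ge\ell^{-1}\|Cx-Cy\|_{S^{-1}}^2$ for all $x,y\in\mathcal H$. Suppose that $\operatorname{zer}(A+C)=\{x: 0\in Ax+Cx\}\ne\emptyset$. For $k\in\mathbb N=\{0,1,\dots\}$ let $M_k\colon\mathcal H\to\mathcal H$, $\gamma_k\in\mathbb R$ and $L_k\ge0$ be such that $\inf_k\gamma_k>0$ and $$\|(\gamma_kM_k-S)x-(\gamma_kM_k-S)y\|_{S^{-1}}\le L_k\|x-y\|_S\qquad\text{for all }x,y\in\mathcal H,\ k\in\mathbb N.$$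 Suppose that there is an $\epsilon>0$ such that $1-L_{k-1}-L_k-\tfrac{\gamma_k\ell}{2}\ge\epsilon$ for all $k\ge1$. Then there exists a $\theta\ne0$ with $\theta<1$ (possibly negative) such that 1. there is an $\varepsilon>0$ with $1-\theta-2|\theta|-L_{k-1}-L_k-\gamma_k\tfrac{\ell}{2}\ge\varepsilon$ for all $k\ge1$; and 2. for all $x_{-1},x_0,u_0\in\mathcal H$, the iteration $$\begin{aligned}x_{k+1}&=(M_k+A)^{-1}\bigl(M_kx_k-Cx_k+\gamma_k^{-1}u_k+\gamma_k^{-1}\theta S(x_k-x_{k-1})\bigr),\\ u_{k+1}&=(\gamma_kM_k-S)x_{k+1}-(\gamma_kM_k-S)x_k,\qquad k\in\mathbb N,\end{aligned}$$ is well defined (the set-valued inverse $(M_k+A)^{-1}$ has exactly one value at each point where it is evaluated), generates unique infinite sequences $(x_k)_{k\in\mathbb N}$ and $(u_k)_{k\in\mathbb N}$, and $(x_k)_{k\in\mathbb N}$ converges weakly to some $x^\star\in\operatorname{zer}(A+C)$. -/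

import Mathlib

open Filter Topology
open scoped InnerProductSpace

namespace NonlinearFB

noncomputable section

/-! Set-valued operators `A : H → 2^H` are functions `A : H → Set H`. -/

section Operators

variable {H : Type*} [NormedAddCommGroup H] [InnerProductSpace ℝ H]

/-- The graph `{(x, u) | u ∈ A x}` of a set-valued operator. -/
def graph (A : H → Set H) : Set (H × H) := {p | p.2 ∈ A p.1}

/-- The zeros of a set-valued operator. -/
def zer (A : H → Set H) : Set H := {x | (0 : H) ∈ A x}

/-- The inverse of a set-valued operator: `x ∈ A⁻¹ y` iff `y ∈ A x`. -/
def opInv (A : H → Set H) : H → Set H := fun y => {x | y ∈ A x}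

/-- The sum of a single-valued operator `B` and a set-valued operator `A`,
`x ↦ {B x + a | a ∈ A x}`. -/
def addOp (B : H → H) (A : H → Set H) : H → Set H := fun x => {v | ∃ a ∈ A x, v = B x + a}

/-- Monotonicity of a set-valued operator. -/
def IsMonotoneOp (A : H → Set H) : Prop :=
  ∀ x u y v : H, (x, u) ∈ graph A → (y, v) ∈ graph A → 0 ≤ ⟪u - v, x - y⟫_ℝ

/-- Maximal monotonicity: monotone, and the graph is not properly contained in the graph of a
monotone operator. -/
def IsMaximallyMonotone (A : H → Set H) : Prop :=
  IsMonotoneOp A ∧ ∀ B : H → Set H, IsMonotoneOp B → ¬ graph A ⊂ graph B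

/-- The set `𝒫(H)` of self-adjoint, strongly positive bounded linear operators. -/
def IsScaling [CompleteSpace H] (S : H →L[ℝ] H) : Prop :=
  IsSelfAdjoint S ∧ ∃ m : ℝ, 0 < m ∧ ∀ x : H, m * ‖x‖ ^ 2 ≤ ⟪S x, x⟫_ℝ

/-- The scaled norm `‖x‖_S = √⟨S x, x⟩`. -/
def scaledNorm (S : H →L[ℝ] H) (x : H) : ℝ := √⟪S x, x⟫_ℝ

/-- The operators in `𝒫(H)` are invertible, so that `ContinuousLinearMap.inverse` is the true
inverse `S⁻¹` for them. -/
theorem IsScaling.isInvertible [CompleteSpace H] {S : H →L[ℝ] H} (hS : IsScaling S) :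
    S.IsInvertible := by
  obtain ⟨-, m, hm, h⟩ := hS
  have hco : IsCoercive ((innerSL ℝ).comp S : H →L[ℝ] H →L[ℝ] ℝ) := by
    refine ⟨m, hm, fun x => ?_⟩
    simpa [pow_two, mul_assoc] using h x
  refine ⟨hco.continuousLinearEquivOfBilin, ?_⟩
  ext x
  refine ext_inner_right ℝ fun w => ?_
  simp

/-- `B` is `L`-Lipschitz continuous with respect to `S` (with `L ≥ 0`):
`‖B x - B y‖_{S⁻¹} ≤ L ‖x - y‖_S`. -/
def IsLipschitzWrt (S : H →L[ℝ] H) (L : ℝ) (B : H → H) : Prop :=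
  0 ≤ L ∧ ∀ x y : H, scaledNorm S.inverse (B x - B y) ≤ L * scaledNorm S (x - y)

/-- `C` is `ℓ⁻¹`-cocoercive with respect to `S` (with `ℓ > 0`):
`⟨C x - C y, x - y⟩ ≥ ℓ⁻¹ ‖C x - C y‖²_{S⁻¹}`. -/
def IsCocoerciveWrt (S : H →L[ℝ] H) (ℓ : ℝ) (C : H → H) : Prop :=
  0 < ℓ ∧ ∀ x y : H, ℓ⁻¹ * scaledNorm S.inverse (C x - C y) ^ 2 ≤ ⟪C x - C y, x - y⟫_ℝ

end Operators

section Algorithm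

variable {H : Type*} [NormedAddCommGroup H] [InnerProductSpace ℝ H]

/-- The standing assumptions on the problem `0 ∈ A x + C x`. The convention that `ℓ = 0` if
`C = 0` is built in. -/
structure ProblemAssumption [CompleteSpace H] (A : H → Set H) (C : H → H) (S : H →L[ℝ] H)
    (ℓ : ℝ) : Prop where
  maximallyMonotone : IsMaximallyMonotone A
  scaling : IsScaling S
  cocoercive : C ≠ 0 → IsCocoerciveWrt S ℓ C
  eq_zero : C = 0 → ℓ = 0
  solvable : (zer (addOp C A)).Nonempty

/-- The assumptions on the design parameters: the steps `γ k` are bounded from below by a positive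
number, and `γ k • M k - S` is `L k`-Lipschitz continuous with respect to `S`. -/
structure ParameterAssumption (S : H →L[ℝ] H) (M : ℕ → H → H) (γ L : ℕ → ℝ) : Prop where
  lowerBound : ∃ γ₀ : ℝ, 0 < γ₀ ∧ ∀ k, γ₀ ≤ γ k
  lipschitz : ∀ k, IsLipschitzWrt S (L k) (fun x => γ k • M k x - S x)

/-- The previous iterate `x_{k-1}`, where `xm` stands for `x_{-1}`. -/
def prev (xm : H) (x : ℕ → H) : ℕ → H
  | 0 => xm
  | k + 1 => x k

/-- The sequences `x`, `u` are generated from `x_{-1} = xm`, `x_0 = x0`, `u_0 = u0` by the nonlinear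
forward-backward method with momentum correction and additional momentum `θ`:
`x_{k+1} = (M_k + A)⁻¹ (M_k x_k - C x_k + γ_k⁻¹ u_k + γ_k⁻¹ θ S (x_k - x_{k-1}))` and
`u_{k+1} = (γ_k M_k - S) x_{k+1} - (γ_k M_k - S) x_k`.
The first line says that the value of the set-valued inverse consists of exactly one point and that
`x_{k+1}` is that point. -/
structure IsAddMomentumRun (A : H → Set H) (C : H → H) (S : H →L[ℝ] H) (M : ℕ → H → H)
    (γ : ℕ → ℝ) (θ : ℝ) (xm x0 u0 : H) (x u : ℕ → H) : Prop where
  x_zero : x 0 = x0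
  u_zero : u 0 = u0
  x_succ : ∀ k, opInv (addOp (M k) A)
    (M k (x k) - C (x k) + (γ k)⁻¹ • u k + ((γ k)⁻¹ * θ) • S (x k - prev xm x k)) = {x (k + 1)}
  u_succ : ∀ k, u (k + 1) =
    (γ k • M k (x (k + 1)) - S (x (k + 1))) - (γ k • M k (x k) - S (x k))

/-- Weak convergence of a sequence. -/
def WeaklyConverges (x : ℕ → H) (a : H) : Prop :=
  Tendsto (fun k => toWeakSpace ℝ H (x k)) atTop (𝓝 (toWeakSpace ℝ H a))

end Algorithm

end

end NonlinearFB

/-! A small negative momentum costs little. For `θ ≤ 0` one has `1 - θ - 2|θ| = 1 + θ`, so `θ =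
-ε/2` uses up half of the slack `ε` and leaves `ε/2`.

Well-posedness: the slack forces `L k < 1`, so `M k` is a small perturbation of `(γ k)⁻¹ S`, hence
strongly monotone and Lipschitz. Then `M k + A` is onto (`exists_sub_mem`, from Minty's theorem and
a contraction) and injective.

Convergence: monotonicity of `A` and cocoercivity of `C` make `lyapunov` decrease by a multiple of
the squared step (`lyapunov_succ_le`). So the steps vanish and the distance to each zero converges
(`tendsto_of_mem_zer`). The residuals in `A + C` then tend to `0`, so weak cluster points are zeros
(`mem_zer_of_tendsto`), and Opial's lemma gives one weak limit. -/

namespace NonlinearFB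

/-! ### Minimisation, Minty's theorem and surjectivity. -/

/-- A closed convex subset of `E × ℝ` on which `(p, t) ↦ t + ‖p‖² / 2` is bounded below contains a
minimiser of this function, which satisfies the first order optimality condition. -/
theorem exists_isMin_add_half_sq {E : Type*} [NormedAddCommGroup E] [InnerProductSpace ℝ E]
    [CompleteSpace E] {K : Set (E × ℝ)} (hconv : Convex ℝ K) (hclosed : IsClosed K)
    (hne : K.Nonempty) {b : ℝ} (hb : ∀ p ∈ K, b ≤ p.2 + ‖p.1‖ ^ 2 / 2) :
    ∃ p ∈ K, ∀ q ∈ K, p.2 - ⟪p.1, q.1 - p.1⟫_ℝ ≤ q.2 := by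
  set g : E × ℝ → ℝ := fun p => p.2 + ‖p.1‖ ^ 2 / 2 with hg
  have hbdd : BddBelow (g '' K) := ⟨b, by rintro _ ⟨p, hp, rfl⟩; exact hb p hp⟩
  set d := sInf (g '' K) with hd
  have hdle : ∀ p ∈ K, d ≤ g p := fun p hp => csInf_le hbdd ⟨p, hp, rfl⟩
  have hex : ∀ n : ℕ, ∃ p ∈ K, g p < d + 1 / ((n : ℝ) + 1) := by
    intro n
    obtain ⟨_, ⟨p, hp, rfl⟩, h⟩ := exists_lt_of_csInf_lt (hne.image g)
      (show sInf (g '' K) < d + 1 / ((n : ℝ) + 1) from lt_add_of_pos_right _ (by positivity))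
    exact ⟨p, hp, h⟩
  choose p hpK hpg using hex
  -- The parallelogram law at the midpoint makes the first components of a minimising sequence
  -- Cauchy; the real components then converge because `g` does.
  have hmid : ∀ q ∈ K, ∀ r ∈ K, ‖q.1 - r.1‖ ^ 2 ≤ 4 * (g q + g r - 2 * d) := by
    intro q hq r hr
    have h1 := hdle _ (hconv hq hr (by norm_num : (0 : ℝ) ≤ 1 / 2) (by norm_num : (0 : ℝ) ≤ 1 / 2)
      (by norm_num))
    simp only [hg, Prod.fst_add, Prod.snd_add, Prod.smul_fst, Prod.smul_snd, smul_eq_mul,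
      ← smul_add, norm_smul] at h1 ⊢
    have h2 := parallelogram_law_with_norm ℝ q.1 r.1
    norm_num at h1
    nlinarith
  have h0 : Tendsto (fun n : ℕ => 1 / ((n : ℝ) + 1)) atTop (𝓝 0) :=
    tendsto_one_div_add_atTop_nhds_zero_nat
  have hcau : CauchySeq fun n => (p n).1 := by
    refine cauchySeq_of_le_tendsto_0 (fun n : ℕ => √(8 * (1 / ((n : ℝ) + 1)))) ?_ ?_
    · intro n m N hn hm
      rw [dist_eq_norm]
      apply Real.le_sqrt_of_sq_le
      have h1 := hmid _ (hpK n) _ (hpK m)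
      have h2 := hpg n
      have h3 := hpg m
      have h4 : 1 / ((n : ℝ) + 1) ≤ 1 / ((N : ℝ) + 1) := Nat.one_div_le_one_div hn
      have h5 : 1 / ((m : ℝ) + 1) ≤ 1 / ((N : ℝ) + 1) := Nat.one_div_le_one_div hm
      linarith
    · simpa using (h0.const_mul 8).sqrt
  obtain ⟨a, ha⟩ := cauchySeq_tendsto_of_complete hcau
  have hgp : Tendsto (fun n => g (p n)) atTop (𝓝 d) := by
    refine tendsto_of_tendsto_of_tendsto_of_le_of_le tendsto_const_nhds
      (by simpa using h0.const_add d) (fun n => hdle _ (hpK n)) (fun n => (hpg n).le)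
  have ht : Tendsto (fun n => (p n).2) atTop (𝓝 (d - ‖a‖ ^ 2 / 2)) := by
    have := hgp.sub ((ha.norm.pow 2).div_const 2)
    simpa [hg] using this
  have hmem : (a, d - ‖a‖ ^ 2 / 2) ∈ K :=
    hclosed.mem_of_tendsto (ha.prodMk_nhds ht) (Eventually.of_forall hpK)
  refine ⟨_, hmem, fun q hq => ?_⟩
  simp only
  -- Compare with a point of the segment towards `q`, divide by `s`, and let `s → 0`.
  have key : ∀ s : ℝ, 0 < s → s < 1 →
      0 ≤ q.2 - (d - ‖a‖ ^ 2 / 2) + ⟪a, q.1 - a⟫_ℝ + s * (‖q.1 - a‖ ^ 2 / 2) := by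
    intro s hs hs1
    have h1 := hdle _ (hconv hmem hq (sub_nonneg.2 hs1.le) hs.le (by ring))
    simp only [hg, Prod.fst_add, Prod.snd_add, Prod.smul_fst, Prod.smul_snd, smul_eq_mul] at h1
    have h2 : (1 - s) • a + s • q.1 = a + s • (q.1 - a) := by module
    rw [h2, norm_add_sq_real, norm_smul, inner_smul_right, mul_pow, Real.norm_eq_abs, sq_abs] at h1
    have h3 : 0 ≤ s * (q.2 - (d - ‖a‖ ^ 2 / 2) + ⟪a, q.1 - a⟫_ℝ + s * (‖q.1 - a‖ ^ 2 / 2)) := by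
      linarith
    exact nonneg_of_mul_nonneg_right h3 hs
  have hlim : Tendsto (fun s : ℝ => q.2 - (d - ‖a‖ ^ 2 / 2) + ⟪a, q.1 - a⟫_ℝ
      + s * (‖q.1 - a‖ ^ 2 / 2)) (𝓝[>] 0)
      (𝓝 (q.2 - (d - ‖a‖ ^ 2 / 2) + ⟪a, q.1 - a⟫_ℝ + 0 * (‖q.1 - a‖ ^ 2 / 2))) := by
    refine Tendsto.mono_left (Continuous.tendsto ?_ 0) nhdsWithin_le_nhds
    fun_prop
  have := ge_of_tendsto hlim (by
    filter_upwards [Ioo_mem_nhdsGT (zero_lt_one' ℝ)] with s hs using key s hs.1 hs.2)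
  linarith

section Monotone

variable {H : Type*} [NormedAddCommGroup H] [InnerProductSpace ℝ H]

/-- Otherwise adjoining `(x, u)` would properly enlarge the graph and keep it monotone. -/
theorem IsMaximallyMonotone.mem_of_forall {A : H → Set H} (hA : IsMaximallyMonotone A) {x u : H}
    (h : ∀ y, ∀ v ∈ A y, 0 ≤ ⟪u - v, x - y⟫_ℝ) : u ∈ A x := by
  by_contra hu
  refine hA.2 (fun y => {v | v ∈ A y ∨ (y = x ∧ v = u)}) ?_ ⟨fun p hp => Or.inl hp, fun hsub => ?_⟩
  · rintro y v z w (hv | ⟨rfl, rfl⟩) (hw | ⟨rfl, rfl⟩)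
    · exact hA.1 _ _ _ _ hv hw
    · have := h y v hv
      simp only [← neg_sub v, ← neg_sub y, inner_neg_neg] at this
      exact this
    · exact h _ _ hw
    · simp
  · exact hu (hsub (show (x, u) ∈ graph _ from Or.inr ⟨rfl, rfl⟩))

/-- Minty's theorem at the origin, through the Fitzpatrick function of `A`. -/
theorem exists_neg_mem [CompleteSpace H] {A : H → Set H} (hmono : IsMonotoneOp A)
    (hmax : ∀ x u : H, (∀ y, ∀ v ∈ A y, 0 ≤ ⟪u - v, x - y⟫_ℝ) → u ∈ A x) : ∃ x, -x ∈ A x := by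
  obtain ⟨y₀, v₀, h₀⟩ : ∃ y, ∃ v, v ∈ A y := by
    by_contra! hcon
    exact hcon 0 0 (hmax 0 0 fun y v hv => absurd hv (hcon y v))
  -- The epigraph of the Fitzpatrick function. Monotonicity bounds this function above by the
  -- pairing on the graph (`hgraph`); maximality bounds it below by the pairing everywhere
  -- (`hfitz`).
  let K : Set (WithLp 2 (H × H) × ℝ) := {p | ∀ y, ∀ v ∈ A y,
    ⟪y, p.1.snd⟫_ℝ + ⟪p.1.fst, v⟫_ℝ - ⟪y, v⟫_ℝ ≤ p.2}
  have hgraph : ∀ y, ∀ v ∈ A y, ((WithLp.toLp 2 (y, v), ⟪y, v⟫_ℝ) : WithLp 2 (H × H) × ℝ) ∈ K := by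
    intro y v hv z w hw
    have := hmono y v z w hv hw
    simp only [inner_sub_left, inner_sub_right] at this
    change ⟪z, v⟫_ℝ + ⟪y, w⟫_ℝ - ⟪z, w⟫_ℝ ≤ ⟪y, v⟫_ℝ
    rw [real_inner_comm v z, real_inner_comm w y, real_inner_comm v y, real_inner_comm w z]
    linarith
  have hfitz : ∀ p ∈ K, ⟪p.1.fst, p.1.snd⟫_ℝ ≤ p.2 := by
    intro p hp
    by_contra! hlt
    have hmem : p.1.snd ∈ A p.1.fst := hmax _ _ fun y v hv => by
      have := hp y v hv
      simp only [inner_sub_left, inner_sub_right]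
      rw [real_inner_comm p.1.fst, real_inner_comm p.1.fst, real_inner_comm y, real_inner_comm y]
      linarith
    have := hp _ _ hmem
    linarith
  have hclosed : IsClosed K := by
    simp only [K, Set.ofPred_forall]
    refine isClosed_iInter fun y => isClosed_iInter fun v => isClosed_iInter fun _ => ?_
    exact isClosed_le (by fun_prop) (by fun_prop)
  have hconv : Convex ℝ K := by
    intro p hp q hq a b ha hb hab y v hv
    have h1 := mul_le_mul_of_nonneg_left (hp y v hv) ha
    have h2 := mul_le_mul_of_nonneg_left (hq y v hv) hb
    simp only [Prod.fst_add, Prod.snd_add, Prod.smul_fst, Prod.smul_snd, WithLp.add_fst,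
      WithLp.add_snd, WithLp.smul_fst, WithLp.smul_snd, inner_add_left, inner_add_right,
      inner_smul_left, inner_smul_right, smul_eq_mul, RCLike.conj_to_real]
    have h3 : ⟪y, v⟫_ℝ = a * ⟪y, v⟫_ℝ + b * ⟪y, v⟫_ℝ := by rw [← add_mul, hab, one_mul]
    linarith
  have hb : ∀ p ∈ K, 0 ≤ p.2 + ‖p.1‖ ^ 2 / 2 := by
    intro p hp
    have h1 := hfitz p hp
    have h2 := norm_add_sq_real p.1.fst p.1.snd
    rw [WithLp.prod_norm_sq_eq_of_L2]
    nlinarith [sq_nonneg ‖p.1.fst + p.1.snd‖]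
  obtain ⟨p, hpK, hp⟩ := exists_isMin_add_half_sq hconv hclosed ⟨_, hgraph y₀ v₀ h₀⟩ hb
  set x := p.1.fst
  set u := p.1.snd
  -- Optimality tested against graph points. It puts `(-u, -x)` in the graph, and testing at that
  -- very point gives `x + u = 0`.
  have hkey : ∀ y, ∀ v ∈ A y, ‖x + u‖ ^ 2 ≤ ⟪-x - v, -u - y⟫_ℝ := by
    intro y v hv
    have h1 := hp _ (hgraph y v hv)
    have h2 := hfitz p hpK
    have h3 := norm_add_sq_real x u
    simp only [inner_sub_right, WithLp.prod_inner_apply, WithLp.ofLp_fst, WithLp.ofLp_snd] at h1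
    change p.2 - (⟪x, y⟫_ℝ + ⟪u, v⟫_ℝ - (⟪x, x⟫_ℝ + ⟪u, u⟫_ℝ)) ≤ ⟪y, v⟫_ℝ at h1
    rw [real_inner_self_eq_norm_sq, real_inner_self_eq_norm_sq] at h1
    simp only [inner_sub_left, inner_sub_right, inner_neg_left, inner_neg_right]
    rw [real_inner_comm u v, real_inner_comm y v]
    change ⟪x, u⟫_ℝ ≤ p.2 at h2
    linarith
  have hmem : -x ∈ A (-u) := hmax _ _ fun y v hv => (sq_nonneg _).trans (hkey y v hv)
  have h0 : x + u = 0 := by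
    have := hkey _ _ hmem
    simpa using this
  rw [eq_neg_of_add_eq_zero_right h0, neg_neg] at hmem
  exact ⟨x, hmem⟩

/-- Minty's theorem. -/
theorem IsMaximallyMonotone.exists_resolvent [CompleteSpace H] {A : H → Set H}
    (hA : IsMaximallyMonotone A) {τ : ℝ} (hτ : 0 < τ) (w : H) : ∃ x, τ⁻¹ • (w - x) ∈ A x := by
  -- Apply the result at the origin to the maximally monotone operator `τ A - w`.
  suffices h : ∃ x, -x ∈ (fun x => {u | τ⁻¹ • (w + u) ∈ A x}) x by
    simpa [sub_eq_add_neg] using h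
  apply exists_neg_mem
  · intro x u y v hu hv
    have := hA.1 x (τ⁻¹ • (w + u)) y (τ⁻¹ • (w + v)) hu hv
    rw [← smul_sub, add_sub_add_left_eq_sub, inner_smul_left] at this
    exact nonneg_of_mul_nonneg_right this (inv_pos.2 hτ)
  · intro x u h
    refine hA.mem_of_forall fun y v hv => ?_
    have h1 := h y (τ • v - w) (by
      change τ⁻¹ • (w + (τ • v - w)) ∈ A y
      rwa [add_sub_cancel, inv_smul_smul₀ hτ.ne'])
    have h2 : τ⁻¹ • (w + u) - v = τ⁻¹ • (u - (τ • v - w)) := by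
      rw [smul_sub, smul_sub, smul_smul, inv_mul_cancel₀ hτ.ne', smul_add, one_smul]
      abel
    rw [h2, inner_smul_left]
    exact mul_nonneg (inv_pos.2 hτ).le h1

/-- The sum of a maximally monotone operator and a strongly monotone Lipschitz map is onto. -/
theorem IsMaximallyMonotone.exists_sub_mem [CompleteSpace H] {A : H → Set H}
    (hA : IsMaximallyMonotone A) {B : H → H} {β K : ℝ} (hβ : 0 < β)
    (hB : ∀ x y, β * ‖x - y‖ ^ 2 ≤ ⟪B x - B y, x - y⟫_ℝ) (hK : ∀ x y, ‖B x - B y‖ ≤ K * ‖x - y‖)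
    (z : H) : ∃ x, z - B x ∈ A x := by
  wlog hK0 : 0 < K generalizing K
  · refine this (K := 1) (fun x y => (hK x y).trans ?_) one_pos
    gcongr
    linarith
  -- This step minimises `1 - 2τβ + τ²K²`, the squared contraction factor of the forward step. The
  -- solution is the fixed point of forward step plus resolvent.
  set τ := β / K ^ 2 with hτdef
  have hτ : 0 < τ := by positivity
  choose J hJ using hA.exists_resolvent hτ
  have hJ1 : ∀ v w, ‖J v - J w‖ ≤ ‖v - w‖ := by
    intro v w
    have h1 := hA.1 _ _ _ _ (hJ v) (hJ w)
    rw [← smul_sub, inner_smul_left] at h1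
    have h2 := nonneg_of_mul_nonneg_right h1 (show (0 : ℝ) < τ⁻¹ from inv_pos.2 hτ)
    have h3 : v - J v - (w - J w) = (v - w) - (J v - J w) := by abel
    rw [h3, inner_sub_left, real_inner_self_eq_norm_sq] at h2
    have h4 := real_inner_le_norm (v - w) (J v - J w)
    by_contra! hlt
    nlinarith [norm_nonneg (v - w)]
  -- If `β > K`, the root takes its default value `0`; the bounds on `B` then force `x = y` always.
  set q := √(1 - β ^ 2 / K ^ 2) with hq
  have hq1 : q < 1 := by
    rw [hq, Real.sqrt_lt' one_pos]
    have : 0 < β ^ 2 / K ^ 2 := by positivity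
    linarith
  have hG : ∀ x y, ‖(x - τ • B x + τ • z) - (y - τ • B y + τ • z)‖ ≤ q * ‖x - y‖ := by
    intro x y
    have h1 : (x - τ • B x + τ • z) - (y - τ • B y + τ • z) = (x - y) - τ • (B x - B y) := by
      module
    rw [h1, hq, ← Real.sqrt_sq (norm_nonneg (x - y)), ← Real.sqrt_mul' _ (sq_nonneg _)]
    apply Real.le_sqrt_of_sq_le
    rw [norm_sub_sq_real, inner_smul_right, norm_smul, mul_pow, Real.norm_eq_abs, sq_abs,
      real_inner_comm]
    have h2 : τ ^ 2 * ‖B x - B y‖ ^ 2 ≤ τ ^ 2 * (K * ‖x - y‖) ^ 2 := by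
      gcongr
      exact hK x y
    have h3 := mul_le_mul_of_nonneg_left (hB x y) hτ.le
    have h4 : τ ^ 2 * (K * ‖x - y‖) ^ 2 = β ^ 2 / K ^ 2 * ‖x - y‖ ^ 2 := by
      rw [hτdef]
      field_simp
    have h5 : τ * (β * ‖x - y‖ ^ 2) = β ^ 2 / K ^ 2 * ‖x - y‖ ^ 2 := by
      rw [hτdef]
      field_simp
    linarith
  have hcontr : ContractingWith ⟨q, Real.sqrt_nonneg _⟩
      (fun x => J (x - τ • B x + τ • z)) := by
    refine ⟨by exact_mod_cast hq1, LipschitzWith.of_dist_le_mul fun x y => ?_⟩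
    rw [dist_eq_norm, dist_eq_norm]
    exact (hJ1 _ _).trans (hG x y)
  have hfix := hcontr.fixedPoint_isFixedPt
  set x := ContractingWith.fixedPoint _ hcontr
  have h1 := hJ (x - τ • B x + τ • z)
  have h2 : J (x - τ • B x + τ • z) = x := hfix
  rw [h2] at h1
  refine ⟨x, ?_⟩
  convert h1 using 1
  rw [show x - τ • B x + τ • z - x = τ • (z - B x) by module, smul_smul,
    inv_mul_cancel₀ hτ.ne', one_smul]

end Monotone
-- Scaled norms, Lipschitz and cocoercive maps.
section Scaling

variable {H : Type*} [NormedAddCommGroup H] [InnerProductSpace ℝ H]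

theorem scaledNorm_nonneg (S : H →L[ℝ] H) (x : H) : 0 ≤ scaledNorm S x := Real.sqrt_nonneg _

theorem scaledNorm_le (S : H →L[ℝ] H) (x : H) : scaledNorm S x ≤ √‖S‖ * ‖x‖ := by
  rw [scaledNorm, ← Real.sqrt_sq (norm_nonneg x), ← Real.sqrt_mul' _ (sq_nonneg _)]
  apply Real.sqrt_le_sqrt
  calc ⟪S x, x⟫_ℝ ≤ ‖S x‖ * ‖x‖ := real_inner_le_norm _ _
    _ ≤ ‖S‖ * ‖x‖ * ‖x‖ := by gcongr; exact S.le_opNorm x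
    _ = _ := by ring

variable [CompleteSpace H] {S : H →L[ℝ] H}

theorem IsScaling.inner_comm (hS : IsScaling S) (x y : H) : ⟪S x, y⟫_ℝ = ⟪S y, x⟫_ℝ := by
  rw [real_inner_comm x]
  exact (ContinuousLinearMap.isSelfAdjoint_iff_isSymmetric.1 hS.1) x y

theorem IsScaling.inner_nonneg (hS : IsScaling S) (x : H) : 0 ≤ ⟪S x, x⟫_ℝ := by
  obtain ⟨m, hm, h⟩ := hS.2
  exact le_trans (by positivity) (h x)

theorem IsScaling.scaledNorm_sq (hS : IsScaling S) (x : H) :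
    scaledNorm S x ^ 2 = ⟪S x, x⟫_ℝ := Real.sq_sqrt (hS.inner_nonneg x)

theorem IsScaling.abs_inner_le (hS : IsScaling S) (x y : H) :
    |⟪S x, y⟫_ℝ| ≤ scaledNorm S x * scaledNorm S y := by
  rw [scaledNorm, scaledNorm, ← Real.sqrt_mul (hS.inner_nonneg x)]
  apply Real.abs_le_sqrt
  have h : ∀ t : ℝ, 0 ≤ ⟪S x, x⟫_ℝ * (t * t) + 2 * ⟪S x, y⟫_ℝ * t + ⟪S y, y⟫_ℝ := by
    intro t
    have h1 := hS.inner_nonneg (t • x + y)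
    simp only [map_add, map_smul, inner_add_left, inner_add_right, inner_smul_left,
      inner_smul_right, RCLike.conj_to_real] at h1
    rw [hS.inner_comm y x] at h1
    linarith
  have := discrim_le_zero h
  rw [discrim] at this
  linarith

theorem IsScaling.apply_inverse (hS : IsScaling S) (u : H) : S (S.inverse u) = u := by
  obtain ⟨e, rfl⟩ := hS.isInvertible
  simp

theorem IsScaling.scaledNorm_inverse (hS : IsScaling S) (u : H) :
    scaledNorm S.inverse u = scaledNorm S (S.inverse u) := by
  rw [scaledNorm, scaledNorm, hS.apply_inverse, real_inner_comm]

/-- Cauchy–Schwarz for `S` at `S⁻¹ u`, whose `S`-norm is the `S⁻¹`-norm of `u`. -/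
theorem IsScaling.abs_inner_le_inverse (hS : IsScaling S) (u y : H) :
    |⟪u, y⟫_ℝ| ≤ scaledNorm S.inverse u * scaledNorm S y := by
  have := hS.abs_inner_le (S.inverse u) y
  rwa [hS.apply_inverse, ← hS.scaledNorm_inverse] at this

theorem IsScaling.norm_le_inverse (hS : IsScaling S) (u : H) :
    ‖u‖ ≤ √‖S‖ * scaledNorm S.inverse u := by
  have h1 := (le_abs_self _).trans (hS.abs_inner_le_inverse u u)
  rw [real_inner_self_eq_norm_sq] at h1
  have h2 := mul_le_mul_of_nonneg_left (scaledNorm_le S u) (scaledNorm_nonneg S.inverse u)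
  rcases (norm_nonneg u).eq_or_lt with h | h
  · rw [← h]
    exact mul_nonneg (Real.sqrt_nonneg _) (scaledNorm_nonneg _ _)
  · nlinarith

theorem IsScaling.exists_norm_le (hS : IsScaling S) :
    ∃ c : ℝ, 0 < c ∧ ∀ x, ‖x‖ ≤ c * scaledNorm S x := by
  obtain ⟨m, hm, h⟩ := hS.2
  refine ⟨√m⁻¹, by positivity, fun x => ?_⟩
  rw [scaledNorm, ← Real.sqrt_mul (by positivity)]
  apply Real.le_sqrt_of_sq_le
  rw [inv_mul_eq_div, le_div_iff₀ hm, mul_comm]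
  exact h x

theorem IsLipschitzWrt.exists_norm_le (hS : IsScaling S) {L : ℝ} {B : H → H}
    (hB : IsLipschitzWrt S L B) : ∃ K : ℝ, ∀ x y, ‖B x - B y‖ ≤ K * ‖x - y‖ := by
  refine ⟨√‖S‖ * (L * √‖S‖), fun x y => (hS.norm_le_inverse _).trans ?_⟩
  rw [mul_assoc, mul_assoc]
  gcongr
  exact (hB.2 x y).trans (mul_le_mul_of_nonneg_left (scaledNorm_le S _) hB.1)

theorem IsLipschitzWrt.abs_inner_le (hS : IsScaling S) {L : ℝ} {B : H → H}
    (hB : IsLipschitzWrt S L B) (x y z : H) :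
    |⟪B x - B y, z⟫_ℝ| ≤ L * scaledNorm S (x - y) * scaledNorm S z :=
  (hS.abs_inner_le_inverse _ _).trans
    (mul_le_mul_of_nonneg_right (hB.2 x y) (scaledNorm_nonneg _ _))

/-- A cocoercive operator is Lipschitz continuous. -/
theorem IsCocoerciveWrt.isLipschitzWrt (hS : IsScaling S) {ℓ : ℝ} {C : H → H}
    (hC : IsCocoerciveWrt S ℓ C) : IsLipschitzWrt S ℓ C := by
  refine ⟨hC.1.le, fun x y => ?_⟩
  have h1 := (hC.2 x y).trans ((le_abs_self _).trans (hS.abs_inner_le_inverse _ _))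
  rw [inv_mul_le_iff₀ hC.1] at h1
  rcases (scaledNorm_nonneg S.inverse (C x - C y)).eq_or_lt with h | h
  · rw [← h]
    exact mul_nonneg hC.1.le (scaledNorm_nonneg _ _)
  · nlinarith

/-- The three point inequality of a cocoercive operator. -/
theorem IsCocoerciveWrt.neg_le_inner (hS : IsScaling S) {ℓ : ℝ} {C : H → H}
    (hC : IsCocoerciveWrt S ℓ C) (x y d : H) :
    -(ℓ / 4 * ⟪S d, d⟫_ℝ) ≤ ⟪C x - C y, x - y + d⟫_ℝ := by
  have h1 := hC.2 x y
  have h2 := (abs_le.1 (hS.abs_inner_le_inverse (C x - C y) d)).1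
  rw [← hS.scaledNorm_sq d, inner_add_right]
  -- Completing the square: the cocoercivity term absorbs the pairing with `d`, up to `ℓ/4 ‖d‖_S²`.
  have h3 : 0 ≤ ℓ⁻¹ * (scaledNorm S.inverse (C x - C y) - ℓ / 2 * scaledNorm S d) ^ 2 :=
    mul_nonneg (inv_pos.2 hC.1).le (sq_nonneg _)
  have h4 : ℓ⁻¹ * (scaledNorm S.inverse (C x - C y) - ℓ / 2 * scaledNorm S d) ^ 2 =
      ℓ⁻¹ * scaledNorm S.inverse (C x - C y) ^ 2
      - scaledNorm S.inverse (C x - C y) * scaledNorm S d + ℓ / 4 * scaledNorm S d ^ 2 := by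
    have := hC.1.ne'
    field_simp
    ring
  linarith

end Scaling

theorem neg_mem_of_mem_zer {H : Type*} [NormedAddCommGroup H] {A : H → Set H} {C : H → H} {z : H}
    (hz : z ∈ zer (addOp C A)) : -C z ∈ A z := by
  obtain ⟨a, ha, h⟩ := hz
  rwa [neg_eq_of_add_eq_zero_right h.symm]

/-! ### Consequences of the problem assumptions. -/

section Problem

variable {H : Type*} [NormedAddCommGroup H] [InnerProductSpace ℝ H] [CompleteSpace H]
  {A : H → Set H} {C : H → H} {S : H →L[ℝ] H} {ℓ : ℝ}

theorem ProblemAssumption.lipschitzConst_nonneg (h : ProblemAssumption A C S ℓ) : 0 ≤ ℓ := by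
  by_cases hC : C = 0
  · exact (h.eq_zero hC).ge
  · exact (h.cocoercive hC).1.le

theorem ProblemAssumption.neg_le_inner (h : ProblemAssumption A C S ℓ) (x y d : H) :
    -(ℓ / 4 * ⟪S d, d⟫_ℝ) ≤ ⟪C x - C y, x - y + d⟫_ℝ := by
  by_cases hC : C = 0
  · simp [hC, h.eq_zero hC]
  · exact (h.cocoercive hC).neg_le_inner h.scaling x y d

theorem ProblemAssumption.inner_nonneg (h : ProblemAssumption A C S ℓ) (x y : H) :
    0 ≤ ⟪C x - C y, x - y⟫_ℝ := by
  simpa using h.neg_le_inner x y 0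

theorem ProblemAssumption.exists_norm_le (h : ProblemAssumption A C S ℓ) :
    ∃ K : ℝ, ∀ x y, ‖C x - C y‖ ≤ K * ‖x - y‖ := by
  by_cases hC : C = 0
  · exact ⟨0, by simp [hC]⟩
  · exact ((h.cocoercive hC).isLipschitzWrt h.scaling).exists_norm_le h.scaling

/-- Minty's characterisation of the zeros of `A + C`. -/
theorem ProblemAssumption.mem_zer (h : ProblemAssumption A C S ℓ) {x : H}
    (hx : ∀ y, ∀ v ∈ A y, 0 ≤ ⟪-(v + C y), x - y⟫_ℝ) : x ∈ zer (addOp C A) := by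
  obtain ⟨K, hK⟩ := h.exists_norm_le
  -- Solve `x ∈ y + C y + A y`. Testing the hypothesis at this `y` gives `-‖x - y‖² ≥ 0`, so `x =
  -- y`.
  obtain ⟨y, hy⟩ := h.maximallyMonotone.exists_sub_mem (B := fun y => y + C y) (K := 1 + K)
    one_pos (fun y w => by
      rw [add_sub_add_comm, inner_add_left, real_inner_self_eq_norm_sq, one_mul]
      exact le_add_of_nonneg_right (h.inner_nonneg y w))
    (fun y w => by
      rw [add_sub_add_comm, one_add_mul]
      exact (norm_add_le _ _).trans (by gcongr; exact hK y w)) x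
  have h1 := hx y _ hy
  rw [show -(x - (y + C y) + C y) = -(x - y) by abel, inner_neg_left,
    real_inner_self_eq_norm_sq] at h1
  have h2 : x - y = 0 := norm_eq_zero.1 (pow_eq_zero_iff two_ne_zero |>.1
    (le_antisymm (by linarith) (sq_nonneg _)))
  obtain rfl := sub_eq_zero.1 h2
  exact ⟨_, hy, by abel⟩

end Problem

/-! ### Weak limits along ultrafilters and Opial's lemma. -/

section Weak

variable {H : Type*} [NormedAddCommGroup H] [InnerProductSpace ℝ H]

theorem weaklyConverges_of_forall_inner [CompleteSpace H] {x : ℕ → H} {a : H}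
    (h : ∀ w, Tendsto (fun k => ⟪x k, w⟫_ℝ) atTop (𝓝 ⟪a, w⟫_ℝ)) : WeaklyConverges x a := by
  refine (WeakBilin.tendsto_iff_forall_eval_tendsto _ ?_).2 fun f => ?_
  · intro y z hyz
    refine ext_inner_left ℝ fun w => ?_
    exact DFunLike.congr_fun hyz (innerSL ℝ w)
  · obtain ⟨w, rfl⟩ := (InnerProductSpace.toDual ℝ H).surjective f
    have := h w
    simp_rw [real_inner_comm w] at this
    exact this

/-- A bounded sequence converges weakly along every ultrafilter. -/
theorem exists_weak_limit [CompleteSpace H] {x : ℕ → H} {R : ℝ} (hR : ∀ k, ‖x k‖ ≤ R)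
    (U : Ultrafilter ℕ) : ∃ a, ∀ w, Tendsto (fun k => ⟪x k, w⟫_ℝ) U (𝓝 ⟪a, w⟫_ℝ) := by
  obtain ⟨f, -, hf⟩ := (WeakDual.isCompact_closedBall (0 : StrongDual ℝ H) R).ultrafilter_le_nhds
    (U.map fun k => StrongDual.toWeakDual (InnerProductSpace.toDual ℝ H (x k))) (by
      rw [le_principal_iff]
      exact Filter.mem_map.2 (Filter.univ_mem' fun k => by simpa using hR k))
  refine ⟨(InnerProductSpace.toDual ℝ H).symm (WeakDual.toStrongDual f), fun w => ?_⟩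
  have h1 := ((WeakDual.eval_continuous w).tendsto f).comp
    (show Tendsto (fun k => StrongDual.toWeakDual (InnerProductSpace.toDual ℝ H (x k))) U (𝓝 f)
      from hf)
  rw [InnerProductSpace.toDual_symm_apply]
  exact h1

theorem IsScaling.exists_norm_bound [CompleteSpace H] {S : H →L[ℝ] H} (hS : IsScaling S)
    {x : ℕ → H} {z : H} (h : ∃ b, Tendsto (fun k => scaledNorm S (x k - z) ^ 2) atTop (𝓝 b)) :
    ∃ R, ∀ k, ‖x k‖ ≤ R := by
  obtain ⟨b, hb⟩ := h
  obtain ⟨B, hB⟩ := hb.bddAbove_range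
  obtain ⟨c, hc, hle⟩ := hS.exists_norm_le
  refine ⟨c * √B + ‖z‖, fun k => ?_⟩
  have h1 : scaledNorm S (x k - z) ≤ √B := Real.le_sqrt_of_sq_le (hB ⟨k, rfl⟩)
  have h2 := norm_le_norm_sub_add (x k) z
  have h3 := (hle (x k - z)).trans (mul_le_mul_of_nonneg_left h1 hc.le)
  linarith

/-- Opial's lemma in a scaled norm. -/
theorem IsScaling.exists_weaklyConverges [CompleteSpace H] {S : H →L[ℝ] H} (hS : IsScaling S)
    {x : ℕ → H} {Z : Set H} (hne : Z.Nonempty)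
    (hconv : ∀ z ∈ Z, ∃ c, Tendsto (fun k => scaledNorm S (x k - z) ^ 2) atTop (𝓝 c))
    (hmem : ∀ (U : Ultrafilter ℕ) (a : H), (U : Filter ℕ) ≤ atTop →
      (∀ w, Tendsto (fun k => ⟪x k, w⟫_ℝ) U (𝓝 ⟪a, w⟫_ℝ)) → a ∈ Z) :
    ∃ a ∈ Z, WeaklyConverges x a := by
  obtain ⟨z, hz⟩ := hne
  obtain ⟨R, hR⟩ := hS.exists_norm_bound (hconv z hz)
  choose lim hlim using exists_weak_limit hR
  have huniq : ∀ U V : Ultrafilter ℕ, (U : Filter ℕ) ≤ atTop → (V : Filter ℕ) ≤ atTop →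
      lim U = lim V := by
    intro U V hU hV
    obtain ⟨b, hb⟩ := hconv _ (hmem U _ hU (hlim U))
    obtain ⟨c, hc⟩ := hconv _ (hmem V _ hV (hlim V))
    -- The difference of the squared distances to the two limits is affine in `x k`, so this inner
    -- product converges along the whole sequence; its limits along `U` and `V` agree.
    have hd : Tendsto (fun k => ⟪x k, S (lim U - lim V)⟫_ℝ) atTop
        (𝓝 ((c - b - (⟪S (lim V), lim V⟫_ℝ - ⟪S (lim U), lim U⟫_ℝ)) / 2)) := by
      refine (((hc.sub hb).sub_const _).div_const 2).congr fun k => ?_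
      simp only [hS.scaledNorm_sq, map_sub, inner_sub_left, inner_sub_right]
      rw [hS.inner_comm (x k) (lim U), hS.inner_comm (x k) (lim V),
        real_inner_comm (S (lim U)), real_inner_comm (S (lim V))]
      ring
    have h1 := tendsto_nhds_unique (hlim U _) (hd.mono_left hU)
    have h2 := tendsto_nhds_unique (hlim V _) (hd.mono_left hV)
    have h3 : ⟪S (lim U - lim V), lim U - lim V⟫_ℝ = 0 := by
      rw [real_inner_comm, inner_sub_left, h1, h2, sub_self]
    obtain ⟨c, hc, hle⟩ := hS.exists_norm_le
    have h4 := hle (lim U - lim V)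
    rw [scaledNorm, h3, Real.sqrt_zero, mul_zero] at h4
    exact sub_eq_zero.1 (norm_le_zero_iff.1 h4)
  refine ⟨lim (hyperfilter ℕ), hmem _ _ Nat.hyperfilter_le_atTop (hlim _),
    weaklyConverges_of_forall_inner fun w => ?_⟩
  rw [tendsto_iff_ultrafilter]
  intro V hV
  rw [huniq _ V Nat.hyperfilter_le_atTop hV]
  exact hlim V w

end Weak
-- The iteration: well-posedness, energy decrease, convergence.
section Run

variable {H : Type*} [NormedAddCommGroup H] [InnerProductSpace ℝ H]
  {A : H → Set H} {C : H → H} {S : H →L[ℝ] H} {ℓ : ℝ} {M : ℕ → H → H} {γ L : ℕ → ℝ}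
  {θ : ℝ} {xm x0 u0 : H} {x u : ℕ → H}

theorem ParameterAssumption.pos (h : ParameterAssumption S M γ L) (k : ℕ) : 0 < γ k := by
  obtain ⟨γ₀, h0, h1⟩ := h.lowerBound
  exact h0.trans_le (h1 k)

theorem existsUnique_run (h : ∀ k z, ∃ x, opInv (addOp (M k) A) z = {x}) (xm x0 u0 : H) :
    ∃! p : (ℕ → H) × (ℕ → H), IsAddMomentumRun A C S M γ θ xm x0 u0 p.1 p.2 := by
  choose R hR using h
  let next : ℕ → H × H × H → H := fun k p => R k
    (M k p.2.1 - C p.2.1 + (γ k)⁻¹ • p.2.2 + ((γ k)⁻¹ * θ) • S (p.2.1 - p.1))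
  -- The state is `(x_{k-1}, x_k, u_k)`, which turns the scheme into a one-step recursion.
  let s : ℕ → H × H × H := fun k => Nat.rec (xm, x0, u0) (fun k p => (p.2.1, next k p,
    (γ k • M k (next k p) - S (next k p)) - (γ k • M k p.2.1 - S p.2.1))) k
  have hprev : ∀ k, prev xm (fun k => (s k).2.1) k = (s k).1 := by
    rintro (_ | k) <;> rfl
  refine ⟨(fun k => (s k).2.1, fun k => (s k).2.2), ⟨rfl, rfl, fun k => ?_, fun k => rfl⟩, ?_⟩
  · rw [hprev]
    exact hR _ _
  · rintro ⟨x, u⟩ hr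
    have key : ∀ k, prev xm x k = (s k).1 ∧ x k = (s k).2.1 ∧ u k = (s k).2.2 := by
      intro k
      induction k with
      | zero => exact ⟨rfl, hr.x_zero, hr.u_zero⟩
      | succ k ih =>
        obtain ⟨h1, h2, h3⟩ := ih
        have h4 := hr.x_succ k
        simp only at h4
        rw [hR, Set.singleton_eq_singleton_iff, h1, h2, h3] at h4
        have h5 : x (k + 1) = (s (k + 1)).2.1 := h4.symm
        refine ⟨h2, h5, ?_⟩
        have h6 := hr.u_succ k
        simp only at h6
        rw [h6, h5, h2]
    exact Prod.ext (funext fun k => (key k).2.1) (funext fun k => (key k).2.2)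

theorem IsAddMomentumRun.exists_mem (hr : IsAddMomentumRun A C S M γ θ xm x0 u0 x u)
    {k : ℕ} (hγ : 0 < γ k) : ∃ a ∈ A (x (k + 1)), γ k • (a + C (x k)) =
      u k - u (k + 1) - S (x (k + 1) - x k) + θ • S (x k - prev xm x k) := by
  obtain ⟨a, ha, h⟩ : x (k + 1) ∈ opInv (addOp (M k) A) _ := by
    rw [hr.x_succ k]
    exact Set.mem_singleton _
  refine ⟨a, ha, ?_⟩
  rw [← sub_eq_iff_eq_add'] at h
  rw [← h, hr.u_succ, map_sub S (x (k + 1))]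
  simp only [smul_add, smul_sub, smul_smul, ← mul_assoc, mul_inv_cancel₀ hγ.ne', one_smul, one_mul]
  abel

variable [CompleteSpace H]

/-- The kernel operator `M k` is strongly monotone if `L k < 1`. -/
theorem ParameterAssumption.exists_stronglyMonotone (h : ParameterAssumption S M γ L)
    (hS : IsScaling S) {k : ℕ} (hL : L k < 1) :
    ∃ β : ℝ, 0 < β ∧ ∀ x y, β * ‖x - y‖ ^ 2 ≤ ⟪M k x - M k y, x - y⟫_ℝ := by
  obtain ⟨m, hm, hSm⟩ := hS.2
  have hγ := h.pos k
  refine ⟨(γ k)⁻¹ * ((1 - L k) * m), mul_pos (inv_pos.2 hγ) (mul_pos (sub_pos.2 hL) hm),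
    fun x y => ?_⟩
  -- Split `γ M = S + (γ M - S)`: the second part can cancel at most the fraction `L` of `‖x -
  -- y‖_S²`.
  have h1 := (abs_le.1 ((h.lipschitz k).abs_inner_le hS x y (x - y))).1
  rw [mul_assoc, ← sq, hS.scaledNorm_sq, show γ k • M k x - S x - (γ k • M k y - S y) =
    γ k • (M k x - M k y) - S (x - y) by rw [map_sub]; module, inner_sub_left, inner_smul_left,
    RCLike.conj_to_real] at h1
  have h2 := mul_le_mul_of_nonneg_left (hSm (x - y)) (sub_pos.2 hL).le
  rw [mul_assoc, inv_mul_le_iff₀ hγ]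
  linarith

theorem ParameterAssumption.exists_norm_le (h : ParameterAssumption S M γ L)
    (hS : IsScaling S) (k : ℕ) : ∃ K : ℝ, ∀ x y, ‖M k x - M k y‖ ≤ K * ‖x - y‖ := by
  obtain ⟨K, hK⟩ := (h.lipschitz k).exists_norm_le hS
  have hγ := h.pos k
  refine ⟨(γ k)⁻¹ * (K + ‖S‖), fun x y => ?_⟩
  have h1 : M k x - M k y = (γ k)⁻¹ • (γ k • M k x - S x - (γ k • M k y - S y) + S (x - y)) := by
    rw [eq_inv_smul_iff₀ hγ.ne', map_sub]
    module
  rw [h1, norm_smul, Real.norm_of_nonneg (inv_pos.2 hγ).le, mul_assoc, add_mul]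
  gcongr
  exact (norm_add_le _ _).trans (add_le_add (hK x y) (S.le_opNorm _))

theorem exists_opInv_eq_singleton (hA : IsMaximallyMonotone A) (hS : IsScaling S)
    (h : ParameterAssumption S M γ L) {k : ℕ} (hL : L k < 1) (z : H) :
    ∃ x, opInv (addOp (M k) A) z = {x} := by
  obtain ⟨β, hβ, hmono⟩ := h.exists_stronglyMonotone hS hL
  obtain ⟨K, hK⟩ := h.exists_norm_le hS k
  obtain ⟨x, hx⟩ := hA.exists_sub_mem hβ hmono hK z
  refine ⟨x, Set.eq_singleton_iff_unique_mem.2 ⟨⟨_, hx, by abel⟩, ?_⟩⟩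
  rintro y ⟨a, ha, rfl⟩
  have h1 := hA.1 _ _ _ _ hx ha
  have h2 := hmono x y
  rw [show M k y + a - M k x - a = -(M k x - M k y) by abel, inner_neg_left] at h1
  have h3 : ‖x - y‖ ^ 2 ≤ 0 := by
    by_contra! hlt
    linarith [mul_pos hβ hlt]
  have h4 := pow_eq_zero_iff two_ne_zero |>.1 (le_antisymm h3 (sq_nonneg _))
  exact (sub_eq_zero.1 (norm_eq_zero.1 h4)).symm

/-- The basic energy estimate of one iteration. -/
theorem IsAddMomentumRun.energy_step (hr : IsAddMomentumRun A C S M γ θ xm x0 u0 x u)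
    (hprob : ProblemAssumption A C S ℓ) {k : ℕ} (hγ : 0 < γ k) {z : H}
    (hz : z ∈ zer (addOp C A)) :
    scaledNorm S (x (k + 1) - z) ^ 2 - θ * scaledNorm S (x k - z) ^ 2
        + 2 * ⟪u (k + 1), x (k + 1) - z⟫_ℝ
        + (1 - γ k * ℓ / 2) * scaledNorm S (x (k + 1) - x k) ^ 2
      ≤ scaledNorm S (x k - z) ^ 2 - θ * scaledNorm S (prev xm x k - z) ^ 2
        + 2 * ⟪u k, x k - z⟫_ℝ + 2 * ⟪u k, x (k + 1) - x k⟫_ℝ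
        + θ * scaledNorm S (x k - prev xm x k) ^ 2
        + 2 * θ * ⟪S (x k - prev xm x k), x (k + 1) - x k⟫_ℝ := by
  have hS := hprob.scaling
  obtain ⟨a, ha, h⟩ := hr.exists_mem hγ
  have h1 := mul_nonneg hγ.le
    (hprob.maximallyMonotone.1 _ _ _ _ ha (neg_mem_of_mem_zer hz))
  -- `C` is evaluated at `x k` but paired with `x (k + 1) - z`; the mismatch costs `γ ℓ / 4` times
  -- the squared step.
  have h2 := mul_le_mul_of_nonneg_left (hprob.neg_le_inner (x k) z (x (k + 1) - x k)) hγ.le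
  have h3 : x k - z + (x (k + 1) - x k) = x (k + 1) - z := by abel
  rw [h3] at h2
  have h4 : γ k * ⟪a - -C z, x (k + 1) - z⟫_ℝ + γ k * ⟪C (x k) - C z, x (k + 1) - z⟫_ℝ =
      ⟪γ k • (a + C (x k)), x (k + 1) - z⟫_ℝ := by
    rw [← mul_add, ← inner_add_left, inner_smul_left, RCLike.conj_to_real]
    congr 2
    abel
  rw [h] at h4
  set d := x k - prev xm x k with hd
  set e := x (k + 1) - x k with he
  set p := x k - z with hp
  rw [← h3] at h1 h2 h4 ⊢
  rw [show prev xm x k - z = p - d by rw [hp, hd]; abel]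
  simp only [hS.scaledNorm_sq, map_add, map_sub, inner_add_left, inner_add_right,
    inner_sub_left, inner_sub_right, inner_smul_left, RCLike.conj_to_real] at h1 h2 h4 ⊢
  rw [hS.inner_comm e p, hS.inner_comm d p] at h4 ⊢
  linarith

theorem IsAddMomentumRun.abs_inner_le (hr : IsAddMomentumRun A C S M γ θ xm x0 u0 x u)
    (hS : IsScaling S) (hparam : ParameterAssumption S M γ L) (k : ℕ) (y : H) :
    |⟪u (k + 1), y⟫_ℝ| ≤ L k * scaledNorm S (x (k + 1) - x k) * scaledNorm S y := by
  rw [hr.u_succ]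
  exact (hparam.lipschitz k).abs_inner_le hS _ _ _

/-- The Lyapunov function of the method relative to a point `z`. -/
noncomputable def lyapunov (S : H →L[ℝ] H) (L : ℕ → ℝ) (θ : ℝ) (x u : ℕ → H) (z : H) (k : ℕ) : ℝ :=
  scaledNorm S (x (k + 1) - z) ^ 2 - θ * scaledNorm S (x k - z) ^ 2
    + 2 * ⟪u (k + 1), x (k + 1) - z⟫_ℝ + L k * scaledNorm S (x (k + 1) - x k) ^ 2

/-- Young's inequality splits both cross terms. For `θ ≤ 0` the previous-step part of the momentum
term cancels against `θ D²`, so only `L k D²` must be stored in `lyapunov`. The estimate starts at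
`x 1`, since `u 0` and `xm` are arbitrary and obey no Lipschitz bound. -/
theorem IsAddMomentumRun.lyapunov_succ_le (hr : IsAddMomentumRun A C S M γ θ xm x0 u0 x u)
    (hprob : ProblemAssumption A C S ℓ) (hparam : ParameterAssumption S M γ L) (hθ : θ ≤ 0)
    {ε : ℝ} {k : ℕ} (hε : ε ≤ 1 + θ - L k - L (k + 1) - γ (k + 1) * ℓ / 2) {z : H}
    (hz : z ∈ zer (addOp C A)) :
    lyapunov S L θ x u z (k + 1) + ε * scaledNorm S (x (k + 2) - x (k + 1)) ^ 2 ≤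
      lyapunov S L θ x u z k := by
  have hS := hprob.scaling
  have h1 := hr.energy_step hprob (hparam.pos (k + 1)) hz
  have h2 := (abs_le.1 (hr.abs_inner_le hS hparam k (x (k + 2) - x (k + 1)))).2
  have h3 := (abs_le.1 (hS.abs_inner_le (x (k + 1) - x k) (x (k + 2) - x (k + 1)))).1
  have hL := (hparam.lipschitz k).1
  simp only [prev, add_assoc, one_add_one_eq_two] at h1
  simp only [lyapunov, add_assoc, one_add_one_eq_two]
  set D := scaledNorm S (x (k + 1) - x k)
  set E := scaledNorm S (x (k + 2) - x (k + 1))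
  have h4 : 2 * (L k * D * E) ≤ L k * D ^ 2 + L k * E ^ 2 := by
    linarith [mul_nonneg hL (sq_nonneg (D - E))]
  have h5 : θ * ⟪S (x (k + 1) - x k), x (k + 2) - x (k + 1)⟫_ℝ ≤ θ * (-(D * E)) :=
    mul_le_mul_of_nonpos_left h3 hθ
  have h6 : 2 * (θ * (-(D * E))) ≤ -θ * D ^ 2 - θ * E ^ 2 := by
    linarith [mul_nonneg (neg_nonneg.2 hθ) (sq_nonneg (D - E))]
  have h7 := mul_le_mul_of_nonneg_right hε (sq_nonneg E)
  linarith

/-- The stored term `L k D²` absorbs the indefinite pairing with `u (k + 1)`, and `-θ` has the good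
sign. -/
theorem IsAddMomentumRun.le_lyapunov (hr : IsAddMomentumRun A C S M γ θ xm x0 u0 x u)
    (hS : IsScaling S) (hparam : ParameterAssumption S M γ L) (hθ : θ ≤ 0) (z : H) (k : ℕ) :
    (1 - L k) * scaledNorm S (x (k + 1) - z) ^ 2 ≤ lyapunov S L θ x u z k := by
  have h1 := (abs_le.1 (hr.abs_inner_le hS hparam k (x (k + 1) - z))).1
  have h2 := mul_nonneg (neg_nonneg.2 hθ) (sq_nonneg (scaledNorm S (x k - z)))
  have h3 := mul_nonneg (hparam.lipschitz k).1
    (sq_nonneg (scaledNorm S (x (k + 1) - x k) - scaledNorm S (x (k + 1) - z)))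
  rw [lyapunov]
  linarith

/-- The steps of the method vanish, and its distance to every zero converges. -/
theorem IsAddMomentumRun.tendsto_of_mem_zer (hr : IsAddMomentumRun A C S M γ θ xm x0 u0 x u)
    (hprob : ProblemAssumption A C S ℓ) (hparam : ParameterAssumption S M γ L) (hθ : θ ≤ 0)
    {ε : ℝ} (hε0 : 0 < ε) (hε : ∀ k, ε ≤ 1 + θ - L k - L (k + 1) - γ (k + 1) * ℓ / 2) {z : H}
    (hz : z ∈ zer (addOp C A)) :
    Tendsto (fun k => scaledNorm S (x (k + 1) - x k)) atTop (𝓝 0) ∧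
      ∃ c, Tendsto (fun k => scaledNorm S (x k - z) ^ 2) atTop (𝓝 c) := by
  have hS := hprob.scaling
  have hL0 : ∀ k, 0 ≤ L k := fun k => (hparam.lipschitz k).1
  have hL1 : ∀ k, ε ≤ 1 - L k := fun k => by
    have := mul_nonneg (hparam.pos (k + 1)).le hprob.lipschitzConst_nonneg
    linarith [hε k, hL0 (k + 1)]
  have hstep := fun k => hr.lyapunov_succ_le hprob hparam hθ (hε k) hz
  have hlow : ∀ k, ε * scaledNorm S (x (k + 1) - z) ^ 2 ≤ lyapunov S L θ x u z k := fun k =>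
    (mul_le_mul_of_nonneg_right (hL1 k) (sq_nonneg _)).trans (hr.le_lyapunov hS hparam hθ z k)
  have hanti : Antitone (lyapunov S L θ x u z) := antitone_nat_of_succ_le fun k => by
    linarith [hstep k, mul_nonneg hε0.le (sq_nonneg (scaledNorm S (x (k + 2) - x (k + 1))))]
  obtain ⟨c, hc⟩ : ∃ c, Tendsto (lyapunov S L θ x u z) atTop (𝓝 c) :=
    ⟨_, tendsto_atTop_ciInf hanti ⟨0, by
      rintro _ ⟨k, rfl⟩
      exact (mul_nonneg hε0.le (sq_nonneg _)).trans (hlow k)⟩⟩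
  have hD : Tendsto (fun k => scaledNorm S (x (k + 1) - x k)) atTop (𝓝 0) := by
    rw [← tendsto_add_atTop_iff_nat 1]
    have h1 : Tendsto (fun k => √((lyapunov S L θ x u z k - lyapunov S L θ x u z (k + 1)) / ε))
        atTop (𝓝 0) := by
      simpa using (((hc.sub ((tendsto_add_atTop_iff_nat 1).2 hc)).div_const ε).sqrt)
    refine squeeze_zero (fun k => scaledNorm_nonneg _ _) (fun k => ?_) h1
    apply Real.le_sqrt_of_sq_le
    rw [le_div_iff₀ hε0, mul_comm]
    linarith [hstep k]
  refine ⟨hD, ?_⟩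
  obtain ⟨B, hB⟩ : ∃ B, ∀ k, scaledNorm S (x (k + 1) - z) ≤ B :=
    ⟨√(lyapunov S L θ x u z 0 / ε), fun k => by
      apply Real.le_sqrt_of_sq_le
      rw [le_div_iff₀ hε0, mul_comm]
      exact (hlow k).trans (hanti (Nat.zero_le k))⟩
  have hDB : Tendsto (fun k => scaledNorm S (x (k + 1) - x k) * B) atTop (𝓝 0) := by
    simpa using hD.mul_const B
  have hu : Tendsto (fun k => ⟪u (k + 1), x (k + 1) - z⟫_ℝ) atTop (𝓝 0) := by
    refine squeeze_zero_norm (fun k => ?_) hDB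
    refine (hr.abs_inner_le hS hparam k _).trans ?_
    refine mul_le_mul ?_ (hB k) (scaledNorm_nonneg _ _) (scaledNorm_nonneg _ _)
    exact mul_le_of_le_one_left (scaledNorm_nonneg _ _) (by linarith [hL1 k])
  have hi : Tendsto (fun k => ⟪S (x (k + 1) - x k), x (k + 1) - z⟫_ℝ) atTop (𝓝 0) := by
    refine squeeze_zero_norm (fun k => ?_) hDB
    exact (hS.abs_inner_le _ _).trans (mul_le_mul_of_nonneg_left (hB k) (scaledNorm_nonneg _ _))
  have hD2 : Tendsto (fun k => scaledNorm S (x (k + 1) - x k) ^ 2) atTop (𝓝 0) := by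
    simpa using hD.pow 2
  have hLD : Tendsto (fun k => L k * scaledNorm S (x (k + 1) - x k) ^ 2) atTop (𝓝 0) :=
    squeeze_zero (fun k => mul_nonneg (hL0 k) (sq_nonneg _))
      (fun k => mul_le_of_le_one_left (sq_nonneg _) (by linarith [hL1 k])) hD2
  -- Up to vanishing terms, `lyapunov` equals `(1 - θ) ‖x (k + 1) - z‖_S²`.
  refine ⟨_, (tendsto_add_atTop_iff_nat 1).1 ((((((hc.sub (hu.const_mul 2)).sub hLD).add
    ((hD2.sub (hi.const_mul 2)).const_mul θ)).div_const (1 - θ))).congr fun k => ?_)⟩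
  have h1 : scaledNorm S (x k - z) ^ 2 = scaledNorm S (x (k + 1) - z) ^ 2
      - 2 * ⟪S (x (k + 1) - x k), x (k + 1) - z⟫_ℝ + scaledNorm S (x (k + 1) - x k) ^ 2 := by
    rw [show x k - z = (x (k + 1) - z) - (x (k + 1) - x k) by abel]
    set p := x (k + 1) - z
    set e := x (k + 1) - x k
    simp only [hS.scaledNorm_sq, map_sub, inner_sub_left, inner_sub_right]
    rw [hS.inner_comm p e]
    ring
  rw [div_eq_iff (by linarith), lyapunov, h1]
  ring

/-- Weak cluster points of the method are zeros of `A + C`. -/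
theorem IsAddMomentumRun.mem_zer_of_tendsto (hr : IsAddMomentumRun A C S M γ θ xm x0 u0 x u)
    (hprob : ProblemAssumption A C S ℓ) (hparam : ParameterAssumption S M γ L)
    (hL1 : ∀ k, L k ≤ 1) (hD : Tendsto (fun k => scaledNorm S (x (k + 1) - x k)) atTop (𝓝 0))
    {R : ℝ} (hR : ∀ k, ‖x k‖ ≤ R) {F : Filter ℕ} [F.NeBot] (hF : F ≤ atTop) {a : H}
    (ha : ∀ w, Tendsto (fun k => ⟪x k, w⟫_ℝ) F (𝓝 ⟪a, w⟫_ℝ)) : a ∈ zer (addOp C A) := by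
  have hS := hprob.scaling
  obtain ⟨c, hc, hle⟩ := hS.exists_norm_le
  have hd : Tendsto (fun k => x (k + 1) - x k) atTop (𝓝 0) :=
    squeeze_zero_norm (fun k => hle _) (by simpa using hD.const_mul c)
  have hu : Tendsto u atTop (𝓝 0) := by
    rw [← tendsto_add_atTop_iff_nat 1]
    refine squeeze_zero_norm (fun k => ?_) (by simpa using hD.const_mul (√‖S‖))
    refine (hS.norm_le_inverse _).trans ?_
    gcongr
    rw [hr.u_succ]
    exact ((hparam.lipschitz k).2 _ _).trans
      (mul_le_of_le_one_left (scaledNorm_nonneg _ _) (hL1 k))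
  have hp : Tendsto (fun k => x k - prev xm x k) atTop (𝓝 0) :=
    (tendsto_add_atTop_iff_nat 1).1 hd
  choose b hb hbe using fun k => hr.exists_mem (hparam.pos k)
  have hres : Tendsto (fun k => b k + C (x k)) atTop (𝓝 0) := by
    obtain ⟨γ₀, h0, hγ⟩ := hparam.lowerBound
    have h1 : Tendsto (fun k => u k - u (k + 1) - S (x (k + 1) - x k)
        + θ • S (x k - prev xm x k)) atTop (𝓝 0) := by
      have := ((hu.sub ((tendsto_add_atTop_iff_nat 1).2 hu)).sub
        ((S.continuous.tendsto 0).comp hd)).add (((S.continuous.tendsto 0).comp hp).const_smul θ)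
      simpa using this
    refine squeeze_zero_norm (fun k => ?_) (by
      have := h1.norm.const_mul γ₀⁻¹
      rwa [norm_zero, mul_zero] at this)
    rw [← hbe, norm_smul, Real.norm_of_nonneg (hparam.pos k).le, ← mul_assoc]
    refine le_mul_of_one_le_left (norm_nonneg _) ?_
    rw [inv_mul_eq_div, one_le_div h0]
    exact hγ k
  -- `b k` lies in `A (x (k + 1))`, so `C` must be moved to the same point.
  have hres' : Tendsto (fun k => b k + C (x (k + 1))) atTop (𝓝 0) := by
    obtain ⟨K, hK⟩ := hprob.exists_norm_le
    have h1 : Tendsto (fun k => C (x (k + 1)) - C (x k)) atTop (𝓝 0) :=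
      squeeze_zero_norm (fun k => hK _ _) (by simpa using hd.norm.const_mul K)
    simpa using hres.add h1
  refine hprob.mem_zer fun y v hv => ?_
  -- A strongly null residual against a bounded sequence: weak convergence of `x` suffices in the
  -- monotonicity inequality.
  have hinner : Tendsto (fun k => ⟪b k + C (x (k + 1)), x (k + 1) - y⟫_ℝ) atTop (𝓝 0) := by
    refine squeeze_zero_norm (fun k => (norm_inner_le_norm _ _).trans
      (mul_le_mul_of_nonneg_left (b := ‖x (k + 1) - y‖) (c := R + ‖y‖) ?_ (norm_nonneg _)))
      (by simpa using hres'.norm.mul_const (R + ‖y‖))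
    exact (norm_sub_le _ _).trans (by gcongr; exact hR _)
  have hweak : Tendsto (fun k => ⟪x (k + 1), v + C y⟫_ℝ) F (𝓝 ⟪a, v + C y⟫_ℝ) := by
    have h1 : Tendsto (fun k => ⟪x (k + 1) - x k, v + C y⟫_ℝ) F (𝓝 0) := by
      simpa using (hd.mono_left hF).inner (tendsto_const_nhds (x := v + C y))
    simpa [← inner_add_left] using h1.add (ha (v + C y))
  have hlim := (hinner.mono_left hF).sub (hweak.sub_const ⟪y, v + C y⟫_ℝ)
  have hge := ge_of_tendsto' hlim (b := 0) fun k => by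
    have h1 := hprob.maximallyMonotone.1 _ _ _ _ (hb k) hv
    have h2 := hprob.inner_nonneg (x (k + 1)) y
    rw [← inner_sub_left, real_inner_comm (v + C y), ← inner_sub_left,
      show b k + C (x (k + 1)) - (v + C y) = (b k - v) + (C (x (k + 1)) - C y) by abel,
      inner_add_left]
    exact add_nonneg h1 h2
  rw [inner_neg_left, real_inner_comm, inner_sub_left]
  linarith

theorem IsAddMomentumRun.exists_weaklyConverges
    (hr : IsAddMomentumRun A C S M γ θ xm x0 u0 x u)
    (hprob : ProblemAssumption A C S ℓ) (hparam : ParameterAssumption S M γ L) (hθ : θ ≤ 0)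
    {ε : ℝ} (hε0 : 0 < ε) (hε : ∀ k, ε ≤ 1 + θ - L k - L (k + 1) - γ (k + 1) * ℓ / 2) :
    ∃ xs ∈ zer (addOp C A), WeaklyConverges x xs := by
  have hS := hprob.scaling
  have hconv := fun z hz => hr.tendsto_of_mem_zer (z := z) hprob hparam hθ hε0 hε hz
  obtain ⟨z, hz⟩ := hprob.solvable
  have hL1 : ∀ k, L k ≤ 1 := fun k => by
    have := mul_nonneg (hparam.pos (k + 1)).le hprob.lipschitzConst_nonneg
    linarith [hε k, (hparam.lipschitz (k + 1)).1]
  obtain ⟨R, hR⟩ := hS.exists_norm_bound (hconv z hz).2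
  exact hS.exists_weaklyConverges hprob.solvable (fun z hz => (hconv z hz).2) fun U a hU ha =>
    hr.mem_zer_of_tendsto hprob hparam hL1 (hconv z hz).1 hR hU ha

end Run
end NonlinearFB

theorem corollary4p2 {H : Type*} [NormedAddCommGroup H] [InnerProductSpace ℝ H] [CompleteSpace H]
    (A : H → Set H) (C : H → H) (S : H →L[ℝ] H) (ℓ : ℝ)
    (M : ℕ → H → H) (γ L : ℕ → ℝ)
    (hprob : NonlinearFB.ProblemAssumption A C S ℓ)
    (hparam : NonlinearFB.ParameterAssumption S M γ L)
    (hcond : ∃ ε : ℝ, 0 < ε ∧ ∀ k : ℕ, 1 ≤ k → ε ≤ 1 - L (k - 1) - L k - γ k * ℓ / 2) :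
    ∃ θ : ℝ, θ ≠ 0 ∧ θ < 1 ∧
      (∃ ε : ℝ, 0 < ε ∧ ∀ k : ℕ, 1 ≤ k →
        ε ≤ 1 - θ - 2 * |θ| - L (k - 1) - L k - γ k * (ℓ / 2)) ∧
      ∀ xm x0 u0 : H,
        (∃! p : (ℕ → H) × (ℕ → H),
          NonlinearFB.IsAddMomentumRun A C S M γ θ xm x0 u0 p.1 p.2) ∧
        ∀ x u : ℕ → H, NonlinearFB.IsAddMomentumRun A C S M γ θ xm x0 u0 x u →
          ∃ xs ∈ NonlinearFB.zer (NonlinearFB.addOp C A), NonlinearFB.WeaklyConverges x xs := by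
  obtain ⟨ε, hε0, hε⟩ := hcond
  have hℓ := hprob.lipschitzConst_nonneg
  have hL0 : ∀ k, 0 ≤ L k := fun k => (hparam.lipschitz k).1
  -- Shifting the index removes the truncated `k - 1` and lets `hL1` cover `k = 0` as well.
  have hε' : ∀ k, ε / 2 ≤ 1 + -(ε / 2) - L k - L (k + 1) - γ (k + 1) * ℓ / 2 := fun k => by
    have := hε (k + 1) (Nat.le_add_left 1 k)
    rw [Nat.add_sub_cancel] at this
    linarith
  have hL1 : ∀ k, L k < 1 := fun k => by
    have := mul_nonneg (hparam.pos (k + 1)).le hℓ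
    linarith [hε' k, hL0 (k + 1)]
  refine ⟨-(ε / 2), by linarith, by linarith, ⟨ε / 2, half_pos hε0, fun k hk => ?_⟩,
    fun xm x0 u0 => ⟨NonlinearFB.existsUnique_run (fun k z =>
      NonlinearFB.exists_opInv_eq_singleton hprob.maximallyMonotone hprob.scaling hparam
        (hL1 k) z) xm x0 u0, fun x u hr =>
      hr.exists_weaklyConverges hprob hparam (by linarith) (half_pos hε0) hε'⟩⟩
  rw [abs_neg, abs_of_pos (half_pos hε0)]
  linarith [hε k hk]
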